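/- Let $B$ be a complex Brownian measure on $\mathbb{R}$: a centered, jointly Gaussian family $B(A)$ of complex random variables, indexed by the Borel sets $A$ of finite Lebesgue measure, with $E\,B(A)\overline{B(A')}=|A\cap A'|$ and $B(-A)=\overline{B(A)}$ a.s. For an even $\widehat g\in L^2(\mathbb{R};\mathbb{R})$ let $$V(t)=\int_{\mathbb{R}}e^{itx}\,\widehat g(x)\,B(dx),\quad t\ge 0,$$ be the velocity process with spectral filter $\widehat g$, and let $X(t)=\int_0^tV(s)\,ds$ be the associated position process, the integral being taken pathwise over a version of $V$ with continuous sample paths. A discrete-time process $(Z_n)_{n\ge0}$ with finite second moments and constant mean has spectral density $f$ if $f\ge0$ is integrable on $[-\pi,\pi)$ and $\mathrm{Cov}(Z_j,Z_n)=\int_{-\pi}^{\pi}e^{i(j-n)x}f(x)\,dx$ for all $j,n\ge 0$; such an $f$ is determined up to a Lebesgue null set. All series below converge for every $x\in[-\pi,\pi)$. (1) (Fractional generalized Langevin equation.) Let $0<d<\frac12$ and $\zeta,m,k_B,\tau>0$. Put $\beta=1+2d$, $a=\zeta\Gamma(2d+2)\sin(\pi(d+\frac12))$, $b=\zeta\Gamma(2d+2)\cos(\pi(d+\frac12))$,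 $c(d)=\sqrt{2\zeta k_B\tau\,\Gamma(2d+2)\sin(\pi(d+\frac12))}$ and $\kappa(x)=\Gamma(2d+2)\bigl(\sin(\pi(d+\frac12))-i\,\mathrm{sign}(x)\cos(\pi(d+\frac12))\bigr)$. If $$\widehat g(x)=c(d)\,\bigl(a^2+b^2+2bm|x|^{\beta}+m^2|x|^{2\beta}\bigr)^{-1/2}\,|x|^{d},$$ then $Y_n=X(n+1)-X(n)$, $n\ge 0$, has the spectral density $$f_Y(x)=c(d)^2\Bigl(\Bigl|\frac{e^{ix}-1}{ix}\Bigr|^2\Bigl|\frac{1}{\zeta\kappa(x)|x|^{-2d}-imx}\Bigr|^2|x|^{-2d}+|e^{ix}-1|^2\sum_{k\in\mathbb{Z}\setminus\{0\}}\Bigl|\frac{1}{\zeta\kappa(x+2\pi k)|x+2\pi k|^{-2d}-im(x+2\pi k)}\Bigr|^2|x+2\pi k|^{-2(d+1)}\Bigr),\quad x\in[-\pi,\pi),\ x\ne0.$$ (2) (Fractional Ornstein–Uhlenbeck process.) Let $-\frac12<d<\frac12$, $\zeta>0$, $\sigma\in\mathbb{R}$ and $$\widehat g(x)=\sigma\sqrt{\Gamma(2d+2)\sin(\pi(d+\tfrac12))}\;(\zeta^2+x^2)^{-1/2}\,|x|^{-d}.$$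 Then $(V(n))_{n=0,1,\dots}$ has the spectral density $$f_V(x)=\sigma^2\Gamma(2d+2)\sin(\pi(d+\tfrac12))\Bigl(\frac{1}{\zeta^2+x^2}\frac1{|x|^{2d}}+\sum_{k\in\mathbb{Z}\setminus\{0\}}\frac{1}{\zeta^2+(x+2k\pi)^2}\frac{1}{|x+2k\pi|^{2d}}\Bigr),\quad x\in[-\pi,\pi),\ x\ne0,$$ and $Y_n=X(n+1)-X(n)$, $n\ge 0$, has the spectral density $$f_Y(x)=\sigma^2\Gamma(2d+2)\sin(\pi(d+\tfrac12))\Bigl(\Bigl|\frac{1-e^{-ix}}{ix}\Bigr|^2\frac{1}{\zeta^2+x^2}\frac1{|x|^{2d}}+|1-e^{-ix}|^2\sum_{k\in\mathbb{Z}\setminus\{0\}}\frac{1}{\zeta^2+(x+2k\pi)^2}\frac{1}{|x+2k\pi|^{2d+2}}\Bigr),\quad x\in[-\pi,\pi),\ x\ne0.$$ -/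

import Mathlib

open MeasureTheory ProbabilityTheory Filter Set
open scoped Topology ENNReal

noncomputable section

namespace AnomalousDiffusion

/-- A complex Brownian measure on `ℝ` with Hermitian symmetry: a centered jointly Gaussian family
`B A` indexed by the Borel sets `A` of finite Lebesgue measure, with
`E (B A * conj (B A')) = |A ∩ A'|` (that is, `E |B(dx)|² = dx` with orthogonal values on disjoint
sets) and `B (-A) = conj (B A)` almost surely, which makes the spectral integrals below
real-valued for even real filters. These properties determine the law of the family. -/
structure IsBrownianMeasure {Ω : Type*} [MeasurableSpace Ω] (P : Measure Ω)
    (B : Set ℝ → Ω → ℂ) : Prop where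
  gaussian : IsGaussianProcess
    (fun A : {A : Set ℝ // MeasurableSet A ∧ volume A < ∞} => B A.1) P
  centered : ∀ A : Set ℝ, MeasurableSet A → volume A < ∞ → ∫ ω, B A ω ∂P = 0
  covariance : ∀ A A' : Set ℝ, MeasurableSet A → volume A < ∞ →
    MeasurableSet A' → volume A' < ∞ →
    ∫ ω, B A ω * (starRingEnd ℂ) (B A' ω) ∂P = ((volume (A ∩ A')).toReal : ℂ)
  hermitian : ∀ A : Set ℝ, MeasurableSet A → volume A < ∞ →
    ∀ᵐ ω ∂P, B ((fun x : ℝ => -x) ⁻¹' A) ω = (starRingEnd ℂ) (B A ω)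

/-- The integral of a simple function `s = ∑ z, z • 1_{s = z}` against `B`. (The value `z = 0`
contributes nothing.) -/
def simpleIntegral {Ω : Type*} (B : Set ℝ → Ω → ℂ) (s : SimpleFunc ℝ ℂ) (ω : Ω) : ℂ :=
  ∑ z ∈ s.range, z * B (s ⁻¹' {z}) ω

/-- `I = ∫ f(x) B(dx)`: the function `f` is in `L²(ℝ)`, and `I` is the `L²(P)`-limit of the
integrals of square integrable simple functions that converge to `f` in `L²(ℝ)`. -/
def IsStochasticIntegral {Ω : Type*} [MeasurableSpace Ω] (P : Measure Ω)
    (B : Set ℝ → Ω → ℂ) (f : ℝ → ℂ) (I : Ω → ℂ) : Prop :=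
  MemLp f 2 volume ∧ MemLp I 2 P ∧
    ∃ s : ℕ → SimpleFunc ℝ ℂ,
      (∀ n, MemLp (s n) 2 volume) ∧
      Tendsto (fun n => eLpNorm (fun x => s n x - f x) 2 volume) atTop (𝓝 0) ∧
      Tendsto (fun n => eLpNorm (fun ω => simpleIntegral B (s n) ω - I ω) 2 P) atTop (𝓝 0)

/-- `V(t) = ∫ e^{itx} g(x) B(dx)`, `t ≥ 0`, for some complex Brownian measure `B`:
`V` is the stationary velocity process with spectral filter `g`. -/
def IsVelocityProcess {Ω : Type*} [MeasurableSpace Ω] (P : Measure Ω)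
    (g : ℝ → ℝ) (V : ℝ → Ω → ℝ) : Prop :=
  ∃ B : Set ℝ → Ω → ℂ, IsBrownianMeasure P B ∧
    ∀ t : ℝ, 0 ≤ t →
      IsStochasticIntegral P B
        (fun x => Complex.exp (Complex.I * (t : ℂ) * (x : ℂ)) * (g x : ℂ))
        (fun ω => (V t ω : ℂ))

/-- `X` is the position process of the velocity process `V`: `X(t) = ∫₀ᵗ V(s) ds`, `t ≥ 0`, the
pathwise Lebesgue integral being taken over a version of `V` with continuous sample paths. -/
def IsPositionProcess {Ω : Type*} [MeasurableSpace Ω] (P : Measure Ω)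
    (V X : ℝ → Ω → ℝ) : Prop :=
  ∃ η : ℝ → Ω → ℝ,
    (∀ t : ℝ, 0 ≤ t → ∀ᵐ ω ∂P, η t ω = V t ω) ∧
    (∀ᵐ ω ∂P, ContinuousOn (fun t : ℝ => η t ω) (Ici 0)) ∧
    ∀ t : ℝ, 0 ≤ t → ∀ᵐ ω ∂P, X t ω = ∫ s in (0 : ℝ)..t, η s ω

/-- The discrete time process `Z` is weakly stationary with spectral density `f` on `[-π, π)`:
`Cov(Z_j, Z_n) = ∫_{[-π, π)} e^{i(j-n)x} f(x) dx`. -/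
structure HasSpectralDensity {Ω : Type*} [MeasurableSpace Ω] (P : Measure Ω)
    (Z : ℕ → Ω → ℝ) (f : ℝ → ℝ) : Prop where
  memLp : ∀ n, MemLp (Z n) 2 P
  mean : ∀ n, ∫ ω, Z n ω ∂P = ∫ ω, Z 0 ω ∂P
  nonneg : ∀ x ∈ Ico (-Real.pi) Real.pi, 0 ≤ f x
  integrable : IntegrableOn f (Ico (-Real.pi) Real.pi) volume
  covariance : ∀ j n : ℕ,
    ((ProbabilityTheory.covariance (Z j) (Z n) P : ℝ) : ℂ) =
      ∫ x in Ico (-Real.pi) Real.pi,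
        Complex.exp (Complex.I * ((j : ℂ) - (n : ℂ)) * (x : ℂ)) * (f x : ℂ)

/-- The spectral filter of the fractional Ornstein–Uhlenbeck velocity process. -/
def fouFilter (σ ζ d : ℝ) (x : ℝ) : ℝ :=
  σ * √(Real.Gamma (2 * d + 2) * Real.sin (Real.pi * (d + 1 / 2))) *
    (1 / √(ζ ^ 2 + x ^ 2)) * |x| ^ (-d)

/-- The constant `a` of the fractional generalized Langevin equation. -/
def fgleA (ζ d : ℝ) : ℝ := ζ * Real.Gamma (2 * d + 2) * Real.sin (Real.pi * (d + 1 / 2))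

/-- The constant `b` of the fractional generalized Langevin equation. -/
def fgleB (ζ d : ℝ) : ℝ := ζ * Real.Gamma (2 * d + 2) * Real.cos (Real.pi * (d + 1 / 2))

/-- The constant `c(d)`, with Boltzmann constant `kB` and temperature `τ`. -/
def fgleC (ζ kB τ d : ℝ) : ℝ :=
  √(2 * ζ * kB * τ * Real.Gamma (2 * d + 2) * Real.sin (Real.pi * (d + 1 / 2)))

/-- The spectral filter `c(d) (γ₀ + γ₁ |x|^β + γ₂ |x|^{2β})^{-1/2} |x|^d` of the fractional
generalized Langevin equation, with `β = 1 + 2d`, `γ₀ = a² + b²`, `γ₁ = 2bm`, `γ₂ = m²`. -/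
def fgleFilter (ζ m kB τ d : ℝ) (x : ℝ) : ℝ :=
  fgleC ζ kB τ d *
    (1 / √((fgleA ζ d ^ 2 + fgleB ζ d ^ 2) + 2 * fgleB ζ d * m * |x| ^ (1 + 2 * d) +
      m ^ 2 * |x| ^ (2 * (1 + 2 * d)))) * |x| ^ d

/-- `κ(x) = Γ(2H + 1) (sin(Hπ) - i sign(x) cos(Hπ))` with `H = d + 1/2`. -/
def kappa (d : ℝ) (x : ℝ) : ℂ :=
  (Real.Gamma (2 * (d + 1 / 2) + 1) : ℂ) *
    ((Real.sin ((d + 1 / 2) * Real.pi) : ℂ) -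
      Complex.I * (Real.sign x : ℂ) * (Real.cos ((d + 1 / 2) * Real.pi) : ℂ))

/-- `|1 / (ζ κ(x) |x|^{-2d} - i m x)|²`. -/
def fgleTransfer (ζ m d : ℝ) (x : ℝ) : ℝ :=
  ‖1 / ((ζ : ℂ) * kappa d x * ((|x| ^ (-2 * d) : ℝ) : ℂ) -
    Complex.I * (m : ℂ) * (x : ℂ))‖ ^ 2

/-- The `k`-th aliased term of the fGLE increments. -/
def fgleIncrementTerm (ζ m d : ℝ) (x : ℝ) (k : ℤ) : ℝ :=
  fgleTransfer ζ m d (x + 2 * Real.pi * k) * |x + 2 * Real.pi * k| ^ (-2 * (d + 1))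

/-- The spectral density of the unit-time increments of the fGLE position process. -/
def fgleIncrementDensity (ζ m kB τ d : ℝ) (x : ℝ) : ℝ :=
  fgleC ζ kB τ d ^ 2 *
    (‖(Complex.exp (Complex.I * (x : ℂ)) - 1) / (Complex.I * (x : ℂ))‖ ^ 2 *
        fgleTransfer ζ m d x * |x| ^ (-2 * d) +
      ‖Complex.exp (Complex.I * (x : ℂ)) - 1‖ ^ 2 *
        ∑' k : {k : ℤ // k ≠ 0}, fgleIncrementTerm ζ m d x k)

/-- The `k`-th aliased term of the sampled fOU velocity. -/
def fouVelocityTerm (ζ d : ℝ) (x : ℝ) (k : ℤ) : ℝ :=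
  1 / (ζ ^ 2 + (x + 2 * k * Real.pi) ^ 2) * (1 / |x + 2 * k * Real.pi| ^ (2 * d))

/-- The spectral density of the fOU velocity process sampled at the integers. -/
def fouVelocityDensity (σ ζ d : ℝ) (x : ℝ) : ℝ :=
  σ ^ 2 * Real.Gamma (2 * d + 2) * Real.sin (Real.pi * (d + 1 / 2)) *
    (1 / (ζ ^ 2 + x ^ 2) * (1 / |x| ^ (2 * d)) +
      ∑' k : {k : ℤ // k ≠ 0}, fouVelocityTerm ζ d x k)

/-- The `k`-th aliased term of the fOU increments. -/
def fouIncrementTerm (ζ d : ℝ) (x : ℝ) (k : ℤ) : ℝ :=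
  1 / (ζ ^ 2 + (x + 2 * k * Real.pi) ^ 2) * (1 / |x + 2 * k * Real.pi| ^ (2 * d + 2))

/-- The spectral density of the unit-time increments of the fOU position process. -/
def fouIncrementDensity (σ ζ d : ℝ) (x : ℝ) : ℝ :=
  σ ^ 2 * Real.Gamma (2 * d + 2) * Real.sin (Real.pi * (d + 1 / 2)) *
    (‖(1 - Complex.exp (-(Complex.I * (x : ℂ)))) / (Complex.I * (x : ℂ))‖ ^ 2 *
        (1 / (ζ ^ 2 + x ^ 2)) * (1 / |x| ^ (2 * d)) +
      ‖1 - Complex.exp (-(Complex.I * (x : ℂ)))‖ ^ 2 *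
        ∑' k : {k : ℤ // k ≠ 0}, fouIncrementTerm ζ d x k)

end AnomalousDiffusion

end

/-! By the Itô isometry, `V` has covariance `E V(s)V(t) = ∫ e^{i(s-t)x} g(x)² dx`; simple functions
give it from `E B(A) conj B(A') = |A ∩ A'|`, and `L²` limits extend it. So `t ↦ V(t)` is a
continuous curve in `L²(P)`, and averaging it over `[a, a+1]` multiplies the spectral measure `g²
dx` by `|(e^{ix}-1)/(ix)|²`. The increment of `X` is a pathwise integral, while this average is an
`L²`-valued one. They agree because the same Riemann sums converge to the first almost surely and to
the second in `L²` (`exists_L2_velocity`).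

At integer lags `e^{i(j-n)x}` is `2π`-periodic, so integrals over the line fold onto `[-π, π)` and
the density becomes a sum over the translates `x + 2πk` (`setIntegral_exp_mul_of_hasSum`). For
increments, `|e^{ix}-1|²` is also periodic and leaves the sum, so only `1/(x+2πk)²` is aliased.

What remains is special to each filter: its square must match the stated terms, which for the fGLE
is the identity `fgleTransfer_eq`, and the series over `k ≠ 0` must converge, by comparison with `∑
|k|^{-p}` for some `p > 1`. -/

noncomputable section

namespace AnomalousDiffusion

/-! ### Second moments as inner products in `L²`. -/

section L2

variable {α : Type*} [MeasurableSpace α] {μ : Measure α}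

lemma inner_toLp_eq_integral {f g : α → ℂ} (hf : MemLp f 2 μ) (hg : MemLp g 2 μ) :
    inner ℂ (hf.toLp f) (hg.toLp g) = ∫ x, g x * (starRingEnd ℂ) (f x) ∂μ := by
  rw [L2.inner_def]
  refine integral_congr_ae ?_
  filter_upwards [hf.coeFn_toLp, hg.coeFn_toLp] with x h₁ h₂
  rw [h₁, h₂, RCLike.inner_apply]

lemma integrable_mul_conj {f g : α → ℂ} (hf : MemLp f 2 μ) (hg : MemLp g 2 μ) :
    Integrable (fun x => f x * (starRingEnd ℂ) (g x)) μ :=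
  hf.integrable_mul hg.star

/-- The product `E (Z W̄)` is continuous along `L²` convergence of both factors. -/
lemma tendsto_integral_mul_conj {f g : ℕ → α → ℂ} {F G : α → ℂ}
    (hf : ∀ n, MemLp (f n) 2 μ) (hg : ∀ n, MemLp (g n) 2 μ)
    (hF : MemLp F 2 μ) (hG : MemLp G 2 μ)
    (hfF : Tendsto (fun n => eLpNorm (fun x => f n x - F x) 2 μ) atTop (𝓝 0))
    (hgG : Tendsto (fun n => eLpNorm (fun x => g n x - G x) 2 μ) atTop (𝓝 0)) :
    Tendsto (fun n => ∫ x, f n x * (starRingEnd ℂ) (g n x) ∂μ) atTop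
      (𝓝 (∫ x, F x * (starRingEnd ℂ) (G x) ∂μ)) := by
  have h₁ := (Lp.tendsto_Lp_iff_tendsto_eLpNorm'' f hf F hF).2 hfF
  have h₂ := (Lp.tendsto_Lp_iff_tendsto_eLpNorm'' g hg G hG).2 hgG
  -- The factors are swapped because the inner product is conjugate-linear in its first slot.
  simpa only [inner_toLp_eq_integral] using h₂.inner (𝕜 := ℂ) h₁

end L2

/-! ### The Itô isometry. -/

section Isometry

variable {Ω : Type*} [MeasurableSpace Ω] {P : Measure Ω} {B : Set ℝ → Ω → ℂ}

lemma IsBrownianMeasure.memLp (hB : IsBrownianMeasure P B) {A : Set ℝ} (hA : MeasurableSet A)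
    (hA' : volume A < ∞) : MemLp (B A) 2 P :=
  (hB.gaussian.hasGaussianLaw_eval ⟨A, hA, hA'⟩).memLp_two

/-- The fibre over `0` of a square integrable simple function has infinite volume, where
`IsBrownianMeasure` gives no control of `B`, so it must be dropped before taking moments. -/
lemma simpleIntegral_eq_sum_filter {Ω : Type*} {B : Set ℝ → Ω → ℂ} (s : SimpleFunc ℝ ℂ) (ω : Ω) :
    simpleIntegral B s ω = ∑ z ∈ s.range with z ≠ 0, z * B (s ⁻¹' {z}) ω := by
  rw [simpleIntegral, Finset.sum_filter_of_ne]
  rintro z - hz rfl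
  simp at hz

lemma simpleFunc_eq_sum_filter (s : SimpleFunc ℝ ℂ) (x : ℝ) :
    s x = ∑ z ∈ s.range with z ≠ 0, z * (s ⁻¹' {z}).indicator 1 x := by
  rw [Finset.sum_filter_of_ne, Finset.sum_eq_single (s x)]
  · simp
  · intro z _ hz
    simp [Set.indicator, hz.symm]
  · intro h
    exact absurd (s.mem_range_self x) h
  · rintro z - hz rfl
    simp at hz

lemma volume_preimage_lt_top {s : SimpleFunc ℝ ℂ} (hs : MemLp s 2 volume) {z : ℂ} (hz : z ≠ 0) :
    volume (s ⁻¹' {z}) < ∞ :=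
  SimpleFunc.measure_preimage_lt_top_of_memLp (by norm_num) (by norm_num) s hs z hz

lemma memLp_simpleIntegral (hB : IsBrownianMeasure P B) {s : SimpleFunc ℝ ℂ}
    (hs : MemLp s 2 volume) : MemLp (simpleIntegral B s) 2 P := by
  have : simpleIntegral B s = fun ω => ∑ z ∈ s.range with z ≠ 0, z * B (s ⁻¹' {z}) ω :=
    funext fun ω => simpleIntegral_eq_sum_filter s ω
  rw [this]
  refine memLp_finsetSum _ fun z hz => ?_
  exact (hB.memLp (s.measurableSet_fiber z)
    (volume_preimage_lt_top hs (Finset.mem_filter.1 hz).2)).const_mul z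

lemma integral_simpleIntegral [IsProbabilityMeasure P] (hB : IsBrownianMeasure P B)
    {s : SimpleFunc ℝ ℂ} (hs : MemLp s 2 volume) : ∫ ω, simpleIntegral B s ω ∂P = 0 := by
  simp_rw [simpleIntegral_eq_sum_filter]
  rw [integral_finsetSum]
  · refine Finset.sum_eq_zero fun z hz => ?_
    rw [integral_const_mul, hB.centered _ (s.measurableSet_fiber z)
      (volume_preimage_lt_top hs (Finset.mem_filter.1 hz).2), mul_zero]
  · intro z hz
    exact ((hB.memLp (s.measurableSet_fiber z)
      (volume_preimage_lt_top hs (Finset.mem_filter.1 hz).2)).integrable (by norm_num)).const_mul z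

/-- Second moments of finite combinations of an `L²` family, expanded bilinearly. -/
lemma integral_sum_mul_conj_sum {α : Type*} [MeasurableSpace α] {μ : Measure α}
    {b : Set ℝ → α → ℂ} (hb : ∀ A, MeasurableSet A → volume A < ∞ → MemLp (b A) 2 μ)
    {s u : SimpleFunc ℝ ℂ} (hs : MemLp s 2 volume) (hu : MemLp u 2 volume) :
    ∫ ω, (∑ z ∈ s.range with z ≠ 0, z * b (s ⁻¹' {z}) ω) *
        (starRingEnd ℂ) (∑ w ∈ u.range with w ≠ 0, w * b (u ⁻¹' {w}) ω) ∂μ =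
      ∑ z ∈ s.range with z ≠ 0, ∑ w ∈ u.range with w ≠ 0, z * (starRingEnd ℂ) w *
        ∫ ω, b (s ⁻¹' {z}) ω * (starRingEnd ℂ) (b (u ⁻¹' {w}) ω) ∂μ := by
  have hi : ∀ z ∈ s.range.filter (· ≠ 0), ∀ w ∈ u.range.filter (· ≠ 0),
      Integrable (fun ω => b (s ⁻¹' {z}) ω * (starRingEnd ℂ) (b (u ⁻¹' {w}) ω)) μ :=
    fun z hz w hw => integrable_mul_conj
      (hb _ (s.measurableSet_fiber z) (volume_preimage_lt_top hs (Finset.mem_filter.1 hz).2))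
      (hb _ (u.measurableSet_fiber w) (volume_preimage_lt_top hu (Finset.mem_filter.1 hw).2))
  have he : ∀ ω, (∑ z ∈ s.range with z ≠ 0, z * b (s ⁻¹' {z}) ω) *
        (starRingEnd ℂ) (∑ w ∈ u.range with w ≠ 0, w * b (u ⁻¹' {w}) ω) =
      ∑ z ∈ s.range with z ≠ 0, ∑ w ∈ u.range with w ≠ 0, z * (starRingEnd ℂ) w *
        (b (s ⁻¹' {z}) ω * (starRingEnd ℂ) (b (u ⁻¹' {w}) ω)) := by
    intro ω
    rw [map_sum, Finset.sum_mul_sum]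
    refine Finset.sum_congr rfl fun z _ => Finset.sum_congr rfl fun w _ => ?_
    rw [map_mul]
    ring
  simp_rw [he]
  rw [integral_finsetSum _ fun z hz =>
    integrable_finsetSum _ fun w hw => (hi z hz w hw).const_mul _]
  refine Finset.sum_congr rfl fun z hz => ?_
  rw [integral_finsetSum _ fun w hw => (hi z hz w hw).const_mul _]
  exact Finset.sum_congr rfl fun w _ => integral_const_mul _ _

/-- One bilinear expansion is applied twice, to `A ↦ B A` under `P` and to `A ↦ 1_A` under Lebesgue
measure. Both families have second moments `|A ∩ A'|`. -/
lemma integral_simpleIntegral_mul_conj (hB : IsBrownianMeasure P B) {s u : SimpleFunc ℝ ℂ}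
    (hs : MemLp s 2 volume) (hu : MemLp u 2 volume) :
    ∫ ω, simpleIntegral B s ω * (starRingEnd ℂ) (simpleIntegral B u ω) ∂P =
      ∫ x, s x * (starRingEnd ℂ) (u x) := by
  have h₁ := integral_sum_mul_conj_sum (fun A hA hA' => hB.memLp hA hA') hs hu
  have h₂ := integral_sum_mul_conj_sum (b := fun A => A.indicator 1) (fun A hA hA' =>
    memLp_indicator_const (μ := (volume : Measure ℝ)) 2 hA (1 : ℂ) (Or.inr hA'.ne)) hs hu
  simp_rw [← simpleIntegral_eq_sum_filter] at h₁
  simp_rw [← simpleFunc_eq_sum_filter] at h₂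
  rw [h₁, h₂]
  refine Finset.sum_congr rfl fun z hz => Finset.sum_congr rfl fun w hw => ?_
  have hz' := volume_preimage_lt_top hs (Finset.mem_filter.1 hz).2
  have hw' := volume_preimage_lt_top hu (Finset.mem_filter.1 hw).2
  rw [hB.covariance _ _ (s.measurableSet_fiber z) hz' (u.measurableSet_fiber w) hw']
  congr 1
  have : ∀ x, (s ⁻¹' {z}).indicator (1 : ℝ → ℂ) x *
      (starRingEnd ℂ) ((u ⁻¹' {w}).indicator (1 : ℝ → ℂ) x) =
      (s ⁻¹' {z} ∩ u ⁻¹' {w}).indicator (1 : ℝ → ℂ) x := by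
    intro x
    by_cases h₁ : x ∈ s ⁻¹' {z} <;> by_cases h₂ : x ∈ u ⁻¹' {w} <;>
      simp only [Set.indicator, h₁, h₂, Set.mem_inter_iff] <;> simp
  simp_rw [this]
  rw [integral_indicator ((s.measurableSet_fiber z).inter (u.measurableSet_fiber w))]
  simp [Measure.real]

/-- The Itô isometry for integrals against a Brownian measure. -/
lemma IsStochasticIntegral.integral_mul_conj (hB : IsBrownianMeasure P B) {f h : ℝ → ℂ}
    {I J : Ω → ℂ} (hI : IsStochasticIntegral P B f I) (hJ : IsStochasticIntegral P B h J) :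
    ∫ ω, I ω * (starRingEnd ℂ) (J ω) ∂P = ∫ x, f x * (starRingEnd ℂ) (h x) := by
  obtain ⟨hf, hI, s, hs, hsf, hsI⟩ := hI
  obtain ⟨hh, hJ, u, hu, huh, huJ⟩ := hJ
  have h₁ := tendsto_integral_mul_conj hs hu hf hh hsf huh
  have h₂ := tendsto_integral_mul_conj (fun n => memLp_simpleIntegral hB (hs n))
    (fun n => memLp_simpleIntegral hB (hu n)) hI hJ hsI huJ
  simp_rw [integral_simpleIntegral_mul_conj hB (hs _) (hu _)] at h₂
  exact tendsto_nhds_unique h₂ h₁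

lemma IsStochasticIntegral.integral_eq_zero [IsProbabilityMeasure P] (hB : IsBrownianMeasure P B)
    {f : ℝ → ℂ} {I : Ω → ℂ} (hI : IsStochasticIntegral P B f I) : ∫ ω, I ω ∂P = 0 := by
  obtain ⟨hf, hI, s, hs, hsf, hsI⟩ := hI
  -- The mean is the pairing with the constant `1`, so it passes to the `L²` limit.
  have h := tendsto_integral_mul_conj (fun n => memLp_simpleIntegral hB (hs n))
    (fun _ => memLp_const (1 : ℂ)) hI (memLp_const (1 : ℂ)) hsI (by simp)
  simp only [map_one, mul_one, integral_simpleIntegral hB (hs _)] at h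
  exact (tendsto_nhds_unique h tendsto_const_nhds)

end Isometry

/-! ### Riemann sums of vector-valued functions. -/

section RiemannSum

variable {E : Type*} [NormedAddCommGroup E] [NormedSpace ℝ E]

/-- The left Riemann sum of `φ` over `[a, a + 1]` with `N` equal steps. -/
def riemannSum (φ : ℝ → E) (a : ℝ) (N : ℕ) : E :=
  (N : ℝ)⁻¹ • ∑ k ∈ Finset.range N, φ (a + k / N)

lemma norm_riemannSum_le {φ : ℝ → E} {C : ℝ} (hC : 0 ≤ C) (hφ : ∀ s, ‖φ s‖ ≤ C) (a : ℝ) (N : ℕ) :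
    ‖riemannSum φ a N‖ ≤ C := by
  rcases Nat.eq_zero_or_pos N with rfl | hN
  · simpa [riemannSum] using hC
  have hN' : (0 : ℝ) < N := Nat.cast_pos.2 hN
  have h : ‖∑ k ∈ Finset.range N, φ (a + k / N)‖ ≤ N * C := by
    refine (norm_sum_le_of_le _ fun k _ => hφ _).trans ?_
    simp
  rw [riemannSum, norm_smul, Real.norm_of_nonneg (inv_nonneg.2 hN'.le), inv_mul_le_iff₀ hN']
  exact h

/-- Uniform continuity bounds the error on each of the `N` cells by `ε/2 · 1/N`. The target is a
general Banach space so as to cover sample paths, characters and `L²(P)`-valued curves alike. -/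
lemma tendsto_riemannSum [CompleteSpace E] {φ : ℝ → E} {a : ℝ}
    (hφ : ContinuousOn φ (Icc a (a + 1))) :
    Tendsto (riemannSum φ a) atTop (𝓝 (∫ s in a..a + 1, φ s)) := by
  rw [Metric.tendsto_atTop]
  intro ε hε
  obtain ⟨δ, hδ, hu⟩ := Metric.uniformContinuousOn_iff.1
    (isCompact_Icc.uniformContinuousOn_of_continuous hφ) (ε / 2) (half_pos hε)
  obtain ⟨M, hM⟩ := exists_nat_one_div_lt hδ
  refine ⟨M + 1, fun N hN => ?_⟩
  have hN' : (0 : ℝ) < N := Nat.cast_pos.2 (by omega)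
  have hNδ : 1 / (N : ℝ) < δ := by
    refine lt_of_le_of_lt (one_div_le_one_div_of_le (by positivity) ?_) hM
    exact_mod_cast hN
  have hmem : ∀ k : ℕ, k ≤ N → a + k / N ∈ Icc a (a + 1) := by
    intro k hk
    have : (k : ℝ) / N ≤ 1 := (div_le_one hN').2 (by exact_mod_cast hk)
    have : (0 : ℝ) ≤ (k : ℝ) / N := by positivity
    constructor <;> linarith
  have hstep : ∀ k : ℕ, a + (k : ℝ) / N ≤ a + ((k + 1 : ℕ) : ℝ) / N := by
    intro k
    gcongr
    exact_mod_cast k.le_succ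
  have hwidth : ∀ k : ℕ, a + ((k + 1 : ℕ) : ℝ) / N - (a + (k : ℝ) / N) = 1 / N := by
    intro k
    push_cast
    ring
  have hint : ∀ k < N,
      IntervalIntegrable φ volume (a + (k : ℕ) / N) (a + ((k + 1 : ℕ) : ℝ) / N) := by
    intro k hk
    refine (hφ.mono ?_).intervalIntegrable_of_Icc (hstep k)
    exact Icc_subset_Icc (hmem k hk.le).1 (hmem (k + 1) hk).2
  have hsum := intervalIntegral.sum_integral_adjacent_intervals
    (a := fun k : ℕ => a + (k : ℝ) / N) hint
  have hends : a + ((0 : ℕ) : ℝ) / N = a ∧ a + (N : ℝ) / N = a + 1 := by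
    constructor
    · simp
    · rw [div_self hN'.ne']
  simp only [hends.1, hends.2] at hsum
  rw [dist_eq_norm, ← hsum, riemannSum, Finset.smul_sum, ← Finset.sum_sub_distrib]
  have hterm : ∀ k ∈ Finset.range N, ‖(N : ℝ)⁻¹ • φ (a + k / N) -
      ∫ s in (a + (k : ℝ) / N)..(a + ((k + 1 : ℕ) : ℝ) / N), φ s‖ ≤ ε / 2 * (1 / N) := by
    intro k hk
    have hk := Finset.mem_range.1 hk
    have hc : (N : ℝ)⁻¹ • φ (a + k / N) =
        ∫ _ in (a + (k : ℝ) / N)..(a + ((k + 1 : ℕ) : ℝ) / N), φ (a + k / N) := by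
      rw [intervalIntegral.integral_const, hwidth, one_div]
    rw [hc, ← intervalIntegral.integral_sub intervalIntegrable_const (hint k hk)]
    have hb := intervalIntegral.norm_integral_le_of_norm_le_const (C := ε / 2)
      (f := fun s => φ (a + k / N) - φ s) (a := a + (k : ℝ) / N)
      (b := a + ((k + 1 : ℕ) : ℝ) / N) ?_
    · rwa [hwidth, abs_of_pos (by positivity)] at hb
    · intro s hs
      rw [uIoc_of_le (hstep k)] at hs
      rw [← dist_eq_norm]
      refine (hu _ (hmem k hk.le) s
        ⟨(hmem k hk.le).1.trans hs.1.le, hs.2.trans (hmem (k + 1) hk).2⟩ ?_).le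
      rw [Real.dist_eq, abs_lt]
      have := hwidth k
      constructor <;> linarith [hs.1, hs.2]
  calc _ ≤ ∑ _k ∈ Finset.range N, ε / 2 * (1 / N) := norm_sum_le_of_le _ hterm
    _ = ε / 2 := by
      rw [Finset.sum_const, Finset.card_range, nsmul_eq_mul]
      field_simp
    _ < ε := half_lt_self hε

end RiemannSum

/-! ### Stationary curves in a Hilbert space and their unit averages. -/

section Stationary

/-- The average of the character `s ↦ e^{isx}` over `[a, a + 1]`. -/
def charAverage (a x : ℝ) : ℂ := ∫ s in a..a + 1, Complex.exp (Complex.I * (s : ℂ) * (x : ℂ))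

lemma norm_exp_I_mul_mul (s x : ℝ) : ‖Complex.exp (Complex.I * (s : ℂ) * (x : ℂ))‖ = 1 := by
  rw [mul_assoc, ← Complex.ofReal_mul, mul_comm, Complex.norm_exp_ofReal_mul_I]

lemma conj_exp_I_mul_mul (s x : ℝ) : (starRingEnd ℂ) (Complex.exp (Complex.I * (s : ℂ) * (x : ℂ))) =
    Complex.exp (-(Complex.I * (s : ℂ) * (x : ℂ))) := by
  rw [← Complex.exp_conj]
  simp

lemma exp_mul_conj_exp (s t x : ℝ) : Complex.exp (Complex.I * (s : ℂ) * (x : ℂ)) *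
    (starRingEnd ℂ) (Complex.exp (Complex.I * (t : ℂ) * (x : ℂ))) =
    Complex.exp (Complex.I * ((s : ℂ) - (t : ℂ)) * (x : ℂ)) := by
  rw [conj_exp_I_mul_mul, ← Complex.exp_add]
  congr 1
  ring

lemma integrable_exp_mul {G : ℝ → ℝ} (hG : Integrable G) (s : ℝ) :
    Integrable (fun x : ℝ => Complex.exp (Complex.I * (s : ℂ) * (x : ℂ)) * (G x : ℂ)) := by
  refine hG.ofReal.bdd_mul (c := 1) ?_ (Eventually.of_forall fun x => (norm_exp_I_mul_mul s x).le)
  exact Continuous.aestronglyMeasurable (by fun_prop)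

lemma continuous_integral_exp_mul {G : ℝ → ℝ} (hG : Integrable G) :
    Continuous (fun s : ℝ => ∫ x : ℝ, Complex.exp (Complex.I * (s : ℂ) * (x : ℂ)) * (G x : ℂ)) := by
  refine continuous_of_dominated (bound := fun x => ‖G x‖)
    (fun s => (integrable_exp_mul hG s).aestronglyMeasurable) (fun s => ?_) hG.norm ?_
  · refine Eventually.of_forall fun x => ?_
    rw [norm_mul, norm_exp_I_mul_mul, one_mul, Complex.norm_real]
  · exact Eventually.of_forall fun x => by fun_prop

variable {H : Type*} [NormedAddCommGroup H] [InnerProductSpace ℂ H]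

/-- A curve in a Hilbert space whose correlations are those of a spectral measure `G dx` is
continuous. -/
lemma continuousOn_of_inner_eq {G : ℝ → ℝ} (hG : Integrable G) {v : ℝ → H}
    (hv : ∀ s t : ℝ, 0 ≤ s → 0 ≤ t → inner ℂ (v t) (v s) =
      ∫ x : ℝ, Complex.exp (Complex.I * ((s : ℂ) - (t : ℂ)) * (x : ℂ)) * (G x : ℂ)) :
    ContinuousOn v (Ici 0) := by
  set ρ : ℝ → ℂ := fun s => ∫ x : ℝ, Complex.exp (Complex.I * (s : ℂ) * (x : ℂ)) * (G x : ℂ)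
    with hρ
  have hρc : Continuous ρ := continuous_integral_exp_mul hG
  have hv' : ∀ s t : ℝ, 0 ≤ s → 0 ≤ t → inner ℂ (v t) (v s) = ρ (s - t) := by
    intro s t hs ht
    rw [hv s t hs ht, hρ]
    push_cast
    rfl
  -- Distances depend on `s - t` only, through the continuous function `ρ`, and vanish at lag `0`.
  have hd : ∀ s t : ℝ, 0 ≤ s → 0 ≤ t → ‖v s - v t‖ ^ 2 = 2 * (ρ 0).re - 2 * (ρ (s - t)).re := by
    intro s t hs ht
    have h₁ := @norm_sub_sq ℂ _ _ _ _ (v t) (v s)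
    rw [norm_sub_rev, h₁, hv' s t hs ht, ← inner_self_eq_norm_sq (𝕜 := ℂ) (v t),
      ← inner_self_eq_norm_sq (𝕜 := ℂ) (v s), hv' t t ht ht, hv' s s hs hs, sub_self, sub_self]
    simp only [RCLike.re_to_complex]
    ring
  intro t ht
  have h0 : Tendsto (fun s => ‖v s - v t‖ ^ 2) (𝓝[Ici 0] t) (𝓝 0) := by
    have hc : Tendsto (fun s : ℝ => 2 * (ρ 0).re - 2 * (ρ (s - t)).re) (𝓝[Ici 0] t)
        (𝓝 (2 * (ρ 0).re - 2 * (ρ (t - t)).re)) := by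
      apply tendsto_nhdsWithin_of_tendsto_nhds
      exact Continuous.tendsto (by fun_prop) t
    rw [sub_self, sub_self] at hc
    refine hc.congr' ?_
    filter_upwards [self_mem_nhdsWithin] with s hs
    exact (hd s t hs ht).symm
  rw [ContinuousWithinAt, tendsto_iff_norm_sub_tendsto_zero]
  have := h0.sqrt
  simpa using this

/-- Averaging commutes with the spectral representation of the correlations. -/
lemma inner_integral_of_inner_eq [NormedSpace ℝ H] [IsScalarTower ℝ ℂ H] [CompleteSpace H]
    {G : ℝ → ℝ} (hG : Integrable G) {v : ℝ → H}
    (hv : ∀ s t : ℝ, 0 ≤ s → 0 ≤ t → inner ℂ (v t) (v s) =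
      ∫ x : ℝ, Complex.exp (Complex.I * ((s : ℂ) - (t : ℂ)) * (x : ℂ)) * (G x : ℂ))
    {a b : ℝ} (ha : 0 ≤ a) (hb : 0 ≤ b) :
    inner ℂ (∫ s in b..b + 1, v s) (∫ s in a..a + 1, v s) =
      ∫ x : ℝ, charAverage a x * (starRingEnd ℂ) (charAverage b x) * (G x : ℂ) := by
  have hc := continuousOn_of_inner_eq hG hv
  have hlim : ∀ {c : ℝ}, 0 ≤ c → Tendsto (riemannSum v c) atTop (𝓝 (∫ s in c..c + 1, v s)) :=
    fun h => tendsto_riemannSum (hc.mono fun s hs => h.trans hs.1)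
  have hleft := (hlim hb).inner (𝕜 := ℂ) (hlim ha)
  let e : ℝ → ℝ → ℂ := fun x s => Complex.exp (Complex.I * (s : ℂ) * (x : ℂ))
  -- For Riemann sums the identity is finite bilinearity. The left side converges by continuity of
  -- the inner product; the right side by dominated convergence with bound `|G|`, since averages of
  -- unimodular numbers have modulus at most `1`.
  have hsum : ∀ N : ℕ, inner ℂ (riemannSum v b N) (riemannSum v a N) =
      ∫ x : ℝ, riemannSum (e x) a N * (starRingEnd ℂ) (riemannSum (e x) b N) * (G x : ℂ) := by
    intro N
    have hexp : ∀ x : ℝ,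
        riemannSum (e x) a N * (starRingEnd ℂ) (riemannSum (e x) b N) * (G x : ℂ) =
        ∑ k ∈ Finset.range N, ∑ l ∈ Finset.range N, ((N : ℂ)⁻¹ * (N : ℂ)⁻¹) *
          (Complex.exp (Complex.I * (((a + k / N : ℝ) : ℂ) - ((b + l / N : ℝ) : ℂ)) * (x : ℂ)) *
            (G x : ℂ)) := by
      intro x
      simp only [riemannSum, Complex.real_smul, map_mul, map_sum, Complex.conj_ofReal]
      rw [mul_mul_mul_comm, Finset.sum_mul_sum, Finset.mul_sum, Finset.sum_mul]
      refine Finset.sum_congr rfl fun k _ => ?_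
      rw [Finset.mul_sum, Finset.sum_mul]
      refine Finset.sum_congr rfl fun l _ => ?_
      rw [exp_mul_conj_exp]
      push_cast
      ring
    have hi : ∀ k l : ℕ, Integrable (fun x : ℝ => ((N : ℂ)⁻¹ * (N : ℂ)⁻¹) *
          (Complex.exp (Complex.I * (((a + k / N : ℝ) : ℂ) - ((b + l / N : ℝ) : ℂ)) * (x : ℂ)) *
            (G x : ℂ))) := by
      intro k l
      have := integrable_exp_mul hG ((a + k / N) - (b + l / N))
      rw [Complex.ofReal_sub] at this
      exact this.const_mul _
    simp_rw [hexp]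
    rw [integral_finsetSum _ fun k _ => integrable_finsetSum _ fun l _ => hi k l]
    rw [riemannSum, riemannSum, RCLike.real_smul_eq_coe_smul (K := ℂ),
      RCLike.real_smul_eq_coe_smul (K := ℂ), inner_smul_left, inner_smul_right, inner_sum,
      Finset.mul_sum, Finset.mul_sum]
    refine Finset.sum_congr rfl fun k _ => ?_
    rw [integral_finsetSum _ fun l _ => hi k l, sum_inner, Finset.mul_sum, Finset.mul_sum]
    refine Finset.sum_congr rfl fun l _ => ?_
    rw [integral_const_mul, hv _ _ (by positivity) (by positivity), ← mul_assoc]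
    simp
  have hright : Tendsto (fun N : ℕ => ∫ x : ℝ,
      riemannSum (e x) a N * (starRingEnd ℂ) (riemannSum (e x) b N) * (G x : ℂ)) atTop
      (𝓝 (∫ x : ℝ, charAverage a x * (starRingEnd ℂ) (charAverage b x) * (G x : ℂ))) := by
    have he : ∀ x, Continuous (e x) := fun x => by fun_prop
    have hcont : ∀ (c : ℝ) (N : ℕ), Continuous (fun x => riemannSum (e x) c N) := by
      intro c N
      unfold riemannSum
      fun_prop
    refine tendsto_integral_of_dominated_convergence (fun x => ‖G x‖) (fun N => ?_) hG.norm
      (fun N => Eventually.of_forall fun x => ?_) (Eventually.of_forall fun x => ?_)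
    · exact ((hcont a N).mul (Complex.continuous_conj.comp
        (hcont b N))).aestronglyMeasurable.mul hG.ofReal.aestronglyMeasurable
    · rw [norm_mul, norm_mul, RCLike.norm_conj, Complex.norm_real]
      have h1 : ∀ c, ‖riemannSum (e x) c N‖ ≤ 1 := fun c =>
        norm_riemannSum_le zero_le_one (fun s => (norm_exp_I_mul_mul s x).le) c N
      have := mul_le_one₀ (h1 a) (norm_nonneg _) (h1 b)
      exact mul_le_of_le_one_left (norm_nonneg _) this
    · exact ((tendsto_riemannSum (he x).continuousOn).mul
        ((Complex.continuous_conj.tendsto _).comp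
          (tendsto_riemannSum (he x).continuousOn))).mul_const _
  simp_rw [hsum] at hleft
  exact tendsto_nhds_unique hleft hright

end Stationary

lemma charAverage_eq (a : ℝ) {x : ℝ} (hx : x ≠ 0) :
    charAverage a x = Complex.exp (Complex.I * (a : ℂ) * (x : ℂ)) *
      ((Complex.exp (Complex.I * (x : ℂ)) - 1) / (Complex.I * (x : ℂ))) := by
  have hx' : Complex.I * (x : ℂ) ≠ 0 := mul_ne_zero Complex.I_ne_zero (Complex.ofReal_ne_zero.2 hx)
  have h := integral_exp_mul_complex (a := a) (b := a + 1) hx'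
  have he : charAverage a x = ∫ s in a..a + 1, Complex.exp (Complex.I * (x : ℂ) * (s : ℂ)) := by
    unfold charAverage
    congr 1
    ext s
    congr 1
    ring
  rw [he, h, mul_div_assoc', mul_sub, mul_one, ← Complex.exp_add]
  congr 3
  · push_cast
    ring
  · ring

/-- The average is a phase `e^{iax}` times a factor free of `a`, so the product depends on `a - b`
only: the increments are again stationary. -/
lemma charAverage_mul_conj (a b : ℝ) {x : ℝ} (hx : x ≠ 0) :
    charAverage a x * (starRingEnd ℂ) (charAverage b x) =
      Complex.exp (Complex.I * ((a : ℂ) - (b : ℂ)) * (x : ℂ)) *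
        ((‖(Complex.exp (Complex.I * (x : ℂ)) - 1) / (Complex.I * (x : ℂ))‖ ^ 2 : ℝ) : ℂ) := by
  rw [charAverage_eq a hx, charAverage_eq b hx, map_mul, mul_mul_mul_comm, exp_mul_conj_exp,
    Complex.mul_conj, Complex.normSq_eq_norm_sq]

/-! ### Moments of the velocity and of the position increments. -/

section SpectralRepresentation

variable {Ω : Type*} [MeasurableSpace Ω] {P : Measure Ω} {g : ℝ → ℝ} {V X : ℝ → Ω → ℝ}

lemma IsVelocityProcess.integrable_sq (hV : IsVelocityProcess P g V) :
    Integrable (fun x => g x ^ 2) := by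
  obtain ⟨B, -, h⟩ := hV
  have h0 := (h 0 le_rfl).1
  simp only [Complex.ofReal_zero, mul_zero, zero_mul, Complex.exp_zero, one_mul] at h0
  have := h0.re
  simp only [RCLike.re_to_complex, Complex.ofReal_re] at this
  exact this.integrable_sq

lemma IsVelocityProcess.memLp_ofReal (hV : IsVelocityProcess P g V) {t : ℝ} (ht : 0 ≤ t) :
    MemLp (fun ω => (V t ω : ℂ)) 2 P := by
  obtain ⟨B, -, h⟩ := hV
  exact (h t ht).2.1

lemma IsVelocityProcess.memLp (hV : IsVelocityProcess P g V) {t : ℝ} (ht : 0 ≤ t) :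
    MemLp (V t) 2 P := by
  simpa using (hV.memLp_ofReal ht).re

lemma IsVelocityProcess.integral_ofReal [IsProbabilityMeasure P] (hV : IsVelocityProcess P g V)
    {t : ℝ} (ht : 0 ≤ t) : ∫ ω, (V t ω : ℂ) ∂P = 0 := by
  obtain ⟨B, hB, h⟩ := hV
  exact (h t ht).integral_eq_zero hB

lemma IsVelocityProcess.integral_mul (hV : IsVelocityProcess P g V) {s t : ℝ} (hs : 0 ≤ s)
    (ht : 0 ≤ t) : ∫ ω, (V s ω : ℂ) * (V t ω : ℂ) ∂P =
      ∫ x : ℝ, Complex.exp (Complex.I * ((s : ℂ) - (t : ℂ)) * (x : ℂ)) * ((g x ^ 2 : ℝ) : ℂ) := by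
  obtain ⟨B, hB, h⟩ := hV
  have := (h s hs).integral_mul_conj hB (h t ht)
  simp only [Complex.conj_ofReal] at this
  rw [this]
  congr 1
  ext x
  rw [map_mul, mul_mul_mul_comm, exp_mul_conj_exp, Complex.conj_ofReal]
  push_cast
  ring

lemma IsPositionProcess.increment_ae_eq (hX : IsPositionProcess P V X) :
    ∃ η : ℝ → Ω → ℝ, (∀ t : ℝ, 0 ≤ t → ∀ᵐ ω ∂P, η t ω = V t ω) ∧
      (∀ᵐ ω ∂P, ContinuousOn (fun t : ℝ => η t ω) (Ici 0)) ∧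
      ∀ a : ℝ, 0 ≤ a → ∀ᵐ ω ∂P, X (a + 1) ω - X a ω = ∫ s in a..a + 1, η s ω := by
  obtain ⟨η, h₁, h₂, h₃⟩ := hX
  refine ⟨η, h₁, h₂, fun a ha => ?_⟩
  filter_upwards [h₂, h₃ a ha, h₃ (a + 1) (by positivity)] with ω hc e₁ e₂
  have hi : ∀ b : ℝ, 0 ≤ b → IntervalIntegrable (fun s => η s ω) volume 0 b := fun b hb =>
    (hc.mono fun s hs => hs.1).intervalIntegrable_of_Icc hb
  rw [e₁, e₂, intervalIntegral.integral_interval_sub_left (hi _ (by positivity)) (hi _ ha)]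

/-- The unit increments of the position process, as averages in `L²` of the velocity. -/
lemma exists_L2_velocity [IsProbabilityMeasure P] (hV : IsVelocityProcess P g V)
    (hX : IsPositionProcess P V X) :
    ∃ v : ℝ → Lp ℂ 2 P,
      (∀ s t : ℝ, 0 ≤ s → 0 ≤ t → inner ℂ (v t) (v s) =
        ∫ x : ℝ, Complex.exp (Complex.I * ((s : ℂ) - (t : ℂ)) * (x : ℂ)) * ((g x ^ 2 : ℝ) : ℂ)) ∧
      (∀ t : ℝ, 0 ≤ t → inner ℂ (Lp.const 2 P (1 : ℂ)) (v t) = 0) ∧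
      ∀ a : ℝ, 0 ≤ a →
        (fun ω => ((X (a + 1) ω - X a ω : ℝ) : ℂ)) =ᵐ[P] (∫ s in a..a + 1, v s : Lp ℂ 2 P) := by
  classical
  let v : ℝ → Lp ℂ 2 P := fun t =>
    -- The value `0` at negative times is a filler: nothing is known about `V` there.
    if h : 0 ≤ t then (hV.memLp_ofReal h).toLp (fun ω => (V t ω : ℂ)) else 0
  have hvt : ∀ {t : ℝ} (h : 0 ≤ t), v t = (hV.memLp_ofReal h).toLp _ := fun h => dif_pos h
  have hin : ∀ s t : ℝ, 0 ≤ s → 0 ≤ t → inner ℂ (v t) (v s) =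
      ∫ x : ℝ, Complex.exp (Complex.I * ((s : ℂ) - (t : ℂ)) * (x : ℂ)) * ((g x ^ 2 : ℝ) : ℂ) := by
    intro s t hs ht
    rw [hvt hs, hvt ht, inner_toLp_eq_integral]
    simp only [Complex.conj_ofReal]
    exact hV.integral_mul hs ht
  refine ⟨v, hin, fun t ht => ?_, fun a ha => ?_⟩
  · have h := inner_toLp_eq_integral (memLp_const (μ := P) (p := 2) (1 : ℂ)) (hV.memLp_ofReal ht)
    rw [hvt ht]
    simp only [map_one, mul_one, hV.integral_ofReal ht] at h
    exact h
  · obtain ⟨η, hη, hc, hinc⟩ := hX.increment_ae_eq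
    have hcont := continuousOn_of_inner_eq hV.integrable_sq hin
    have hlim : Tendsto (riemannSum v a) atTop (𝓝 (∫ s in a..a + 1, v s)) :=
      tendsto_riemannSum (hcont.mono fun s hs => ha.trans hs.1)
    -- `L²` convergence gives almost sure convergence along a subsequence, enough to compare with
    -- the pathwise limit.
    obtain ⟨ns, hns, hae⟩ := (tendstoInMeasure_of_tendsto_Lp hlim).exists_seq_tendsto_ae
    -- Only countably many times `a + k/N` occur, so one null set handles every replacement of the
    -- class `v` by the continuous version `η`.
    have hsum : ∀ᵐ ω ∂P, ∀ N : ℕ,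
        (riemannSum v a N : Lp ℂ 2 P) ω = ((riemannSum (fun s => η s ω) a N : ℝ) : ℂ) := by
      rw [ae_all_iff]
      intro N
      have h₁ : ∀ᵐ ω ∂P, ∀ k : ℕ, (v (a + k / N) : Lp ℂ 2 P) ω = (η (a + k / N) ω : ℂ) := by
        rw [ae_all_iff]
        intro k
        have hk : 0 ≤ a + (k : ℝ) / N := by positivity
        rw [hvt hk]
        filter_upwards [(hV.memLp_ofReal hk).coeFn_toLp, hη _ hk] with ω e₁ e₂
        rw [e₁, e₂]
      filter_upwards [h₁, Lp.coeFn_smul ((N : ℝ)⁻¹) (∑ k ∈ Finset.range N, v (a + k / N)),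
        Lp.coeFn_finsetSum (Finset.range N) (fun k : ℕ => v (a + k / N))] with ω e₁ e₂ e₃
      rw [riemannSum, e₂, Pi.smul_apply, e₃, Finset.sum_apply, riemannSum]
      simp [e₁]
    filter_upwards [hae, hsum, hc, hinc a ha] with ω h₁ h₂ h₃ h₄
    rw [h₄]
    have h₅ : Tendsto (riemannSum (fun s => η s ω) a) atTop (𝓝 (∫ s in a..a + 1, η s ω)) :=
      tendsto_riemannSum (h₃.mono fun s hs => ha.trans hs.1)
    have h₆ := (Complex.continuous_ofReal.tendsto _).comp (h₅.comp hns.tendsto_atTop)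
    simp only [h₂] at h₁
    exact tendsto_nhds_unique h₆ h₁

lemma memLp_increment [IsProbabilityMeasure P] (hV : IsVelocityProcess P g V)
    (hX : IsPositionProcess P V X) {a : ℝ} (ha : 0 ≤ a) :
    MemLp (fun ω => X (a + 1) ω - X a ω) 2 P := by
  obtain ⟨v, -, -, h⟩ := exists_L2_velocity hV hX
  simpa using ((memLp_congr_ae (h a ha)).2 (Lp.memLp _)).re

/-- Each Riemann sum of the velocity is orthogonal to the constant `1`, hence so is their `L²`
limit. -/
lemma integral_increment [IsProbabilityMeasure P] (hV : IsVelocityProcess P g V)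
    (hX : IsPositionProcess P V X) {a : ℝ} (ha : 0 ≤ a) :
    ∫ ω, (X (a + 1) ω - X a ω) ∂P = 0 := by
  obtain ⟨v, hin, h0, h⟩ := exists_L2_velocity hV hX
  have hlim : Tendsto (riemannSum v a) atTop (𝓝 (∫ s in a..a + 1, v s)) :=
    tendsto_riemannSum ((continuousOn_of_inner_eq hV.integrable_sq hin).mono
      fun s hs => ha.trans hs.1)
  have hlim' := (tendsto_const_nhds (x := Lp.const 2 P (1 : ℂ))).inner (𝕜 := ℂ) hlim
  have hz : ∀ N, inner ℂ (Lp.const 2 P (1 : ℂ)) (riemannSum v a N) = 0 := by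
    intro N
    rw [riemannSum, RCLike.real_smul_eq_coe_smul (K := ℂ), inner_smul_right, inner_sum,
      Finset.sum_eq_zero fun k _ => h0 _ (by positivity), mul_zero]
  simp_rw [hz] at hlim'
  have he := tendsto_nhds_unique hlim' tendsto_const_nhds
  rw [L2.inner_def] at he
  have hc : ∫ ω, ((X (a + 1) ω - X a ω : ℝ) : ℂ) ∂P = 0 := by
    rw [← he]
    refine integral_congr_ae ?_
    filter_upwards [h a ha, Lp.coeFn_const (μ := P) 2 (1 : ℂ)] with ω e₁ e₂
    rw [e₁, e₂]
    simp
  rwa [integral_complex_ofReal, Complex.ofReal_eq_zero] at hc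

lemma integral_increment_mul [IsProbabilityMeasure P] (hV : IsVelocityProcess P g V)
    (hX : IsPositionProcess P V X) {a b : ℝ} (ha : 0 ≤ a) (hb : 0 ≤ b) :
    ∫ ω, ((X (a + 1) ω - X a ω : ℝ) : ℂ) * ((X (b + 1) ω - X b ω : ℝ) : ℂ) ∂P =
      ∫ x : ℝ, Complex.exp (Complex.I * ((a : ℂ) - (b : ℂ)) * (x : ℂ)) *
        ((‖(Complex.exp (Complex.I * (x : ℂ)) - 1) / (Complex.I * (x : ℂ))‖ ^ 2 * g x ^ 2 : ℝ)
          : ℂ) := by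
  obtain ⟨v, hin, -, h⟩ := exists_L2_velocity hV hX
  have he := inner_integral_of_inner_eq hV.integrable_sq hin ha hb
  -- The origin is removed because the quotient there is `0/0 = 0`, whereas the average of the
  -- character is `1`.
  have hx : ∀ᵐ x : ℝ, x ≠ 0 := by simp [ae_iff]
  rw [L2.inner_def] at he
  calc _ = _ := integral_congr_ae (by
            filter_upwards [h a ha, h b hb] with ω e₁ e₂
            rw [RCLike.inner_apply, ← e₁, ← e₂, Complex.conj_ofReal])
    _ = _ := he
    _ = _ := integral_congr_ae (by
            filter_upwards [hx] with x hx
            rw [charAverage_mul_conj a b hx]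
            push_cast
            ring)

end SpectralRepresentation

/-! ### Folding the line onto one period. -/

section Aliasing

variable {E : Type*} [NormedAddCommGroup E] [NormedSpace ℝ E]

lemma integrableOn_comp_add {E : Type*} [NormedAddCommGroup E] {f : ℝ → E}
    (hf : Integrable f) (c : ℝ) (S : Set ℝ) :
    IntegrableOn (fun x => f (x + c)) S :=
  (hf.comp_add_right c).integrableOn

/-- The integral over the line is the sum of the integrals over the translates of a period. -/
lemma hasSum_setIntegral_comp_add {f : ℝ → E} (hf : Integrable f) :
    HasSum (fun k : ℤ => ∫ x in Ico (-Real.pi) Real.pi, f (x + 2 * Real.pi * k)) (∫ x, f x) := by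
  have hp : (0 : ℝ) < 2 * Real.pi := Real.two_pi_pos
  have h := hasSum_integral_iUnion (μ := volume) (f := f)
    (s := fun k : ℤ => Ico (-Real.pi + k • (2 * Real.pi)) (-Real.pi + (k + 1) • (2 * Real.pi)))
    (fun _ => measurableSet_Ico) (pairwise_disjoint_Ico_add_zsmul _ _) hf.integrableOn
  rw [iUnion_Ico_add_zsmul hp, setIntegral_univ] at h
  refine h.congr_fun fun k => ?_
  have := (measurePreserving_add_right volume (2 * Real.pi * k)).setIntegral_preimage_emb
    (measurableEmbedding_addRight _) f
    (Ico (-Real.pi + k • (2 * Real.pi)) (-Real.pi + (k + 1) • (2 * Real.pi)))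
  rw [← this, preimage_add_const_Ico]
  congr 3 <;> simp only [zsmul_eq_mul] <;> push_cast <;> ring

lemma summable_setIntegral_norm_comp_add {E : Type*} [NormedAddCommGroup E] {f : ℝ → E}
    (hf : Integrable f) :
    Summable (fun k : ℤ => ∫ x in Ico (-Real.pi) Real.pi, ‖f (x + 2 * Real.pi * k)‖) :=
  (hasSum_setIntegral_comp_add hf.norm).summable

/-- Sum and integral may be exchanged because the `L¹` norms over the translated periods add up to
`∫ ‖f‖`. -/
lemma setIntegral_tsum_comp_add {f : ℝ → E} (hf : Integrable f) :
    ∫ x in Ico (-Real.pi) Real.pi, ∑' k : ℤ, f (x + 2 * Real.pi * k) = ∫ x, f x :=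
  (hasSum_integral_of_summable_integral_norm (fun _ : ℤ => integrableOn_comp_add hf _ _)
    (summable_setIntegral_norm_comp_add hf)).unique (hasSum_setIntegral_comp_add hf)

/-- `F` is measurable as an almost everywhere limit of finite partial sums, and Tonelli bounds its
`L¹` norm by the sum of those of `f` over the periods. -/
lemma integrableOn_of_hasSum_comp_add {E : Type*} [NormedAddCommGroup E] {f F : ℝ → E} (hf : Integrable f)
    (hF : ∀ᵐ x ∂volume.restrict (Ico (-Real.pi) Real.pi),
      HasSum (fun k : ℤ => f (x + 2 * Real.pi * k)) (F x)) :
    IntegrableOn F (Ico (-Real.pi) Real.pi) := by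
  have hm : ∀ k : ℤ, AEStronglyMeasurable (fun x => f (x + 2 * Real.pi * k))
      (volume.restrict (Ico (-Real.pi) Real.pi)) :=
    fun k => (integrableOn_comp_add hf _ _).aestronglyMeasurable
  refine ⟨aestronglyMeasurable_of_tendsto_ae (u := (atTop : Filter (Finset ℤ)))
    (f := fun t x => ∑ k ∈ t, f (x + 2 * Real.pi * k))
    (fun t => Finset.aestronglyMeasurable_fun_sum _ fun k _ => hm k) hF, ?_⟩
  rw [hasFiniteIntegral_iff_enorm]
  have hle : ∫⁻ x in Ico (-Real.pi) Real.pi, ‖F x‖ₑ ≤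
      ∫⁻ x in Ico (-Real.pi) Real.pi, ∑' k : ℤ, ‖f (x + 2 * Real.pi * k)‖ₑ := by
    refine lintegral_mono_ae ?_
    filter_upwards [hF] with x hx
    rw [← hx.tsum_eq]
    exact enorm_tsum_le_tsum_enorm
  refine hle.trans_lt ?_
  rw [lintegral_tsum fun k => (hm k).enorm]
  simp_rw [← ofReal_integral_norm_eq_lintegral_enorm (integrableOn_comp_add hf _ _)]
  exact (summable_setIntegral_norm_comp_add hf).tsum_ofReal_lt_top

lemma exp_mul_add_two_pi (m : ℤ) (x : ℝ) (k : ℤ) :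
    Complex.exp (Complex.I * (m : ℂ) * ((x + 2 * Real.pi * k : ℝ) : ℂ)) =
      Complex.exp (Complex.I * (m : ℂ) * (x : ℂ)) := by
  rw [Complex.exp_eq_exp_iff_exists_int]
  refine ⟨m * k, ?_⟩
  push_cast
  ring

/-- Sampling at the integers folds the spectral measure `G dx` onto one period. -/
lemma setIntegral_exp_mul_of_hasSum {G F : ℝ → ℝ} (hG : Integrable G)
    (hF : ∀ᵐ x ∂volume.restrict (Ico (-Real.pi) Real.pi),
      HasSum (fun k : ℤ => G (x + 2 * Real.pi * k)) (F x)) (m : ℤ) :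
    ∫ x in Ico (-Real.pi) Real.pi, Complex.exp (Complex.I * (m : ℂ) * (x : ℂ)) * (F x : ℂ) =
      ∫ x : ℝ, Complex.exp (Complex.I * (m : ℂ) * (x : ℂ)) * (G x : ℂ) := by
  have hi := integrable_exp_mul hG (m : ℝ)
  simp only [Complex.ofReal_intCast] at hi
  rw [← setIntegral_tsum_comp_add hi]
  refine integral_congr_ae ?_
  filter_upwards [hF] with x hx
  simp_rw [exp_mul_add_two_pi]
  have h := (Complex.hasSum_ofReal.2 hx).mul_left (Complex.exp (Complex.I * (m : ℂ) * (x : ℂ)))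
  exact h.tsum_eq.symm

end Aliasing

/-- A centered process whose correlations are the Fourier transform of `G` on the line has the
folded function as a spectral density. -/
lemma hasSpectralDensity_of_hasSum {Ω : Type*} [MeasurableSpace Ω] {P : Measure Ω}
    [IsProbabilityMeasure P] {Z : ℕ → Ω → ℝ} {G F : ℝ → ℝ} (hZ : ∀ n, MemLp (Z n) 2 P)
    (hmean : ∀ n, ∫ ω, Z n ω ∂P = 0) (hG : Integrable G)
    (hcov : ∀ j n : ℕ, ∫ ω, (Z j ω : ℂ) * (Z n ω : ℂ) ∂P =
      ∫ x : ℝ, Complex.exp (Complex.I * ((j : ℂ) - (n : ℂ)) * (x : ℂ)) * (G x : ℂ))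
    (hnonneg : ∀ x ∈ Ico (-Real.pi) Real.pi, 0 ≤ F x)
    (hF : ∀ x ∈ Ico (-Real.pi) Real.pi, x ≠ 0 →
      HasSum (fun k : ℤ => G (x + 2 * Real.pi * k)) (F x)) :
    HasSpectralDensity P Z F := by
  have hF' : ∀ᵐ x ∂volume.restrict (Ico (-Real.pi) Real.pi),
      HasSum (fun k : ℤ => G (x + 2 * Real.pi * k)) (F x) := by
    have h0 : ∀ᵐ x : ℝ, x ≠ 0 := by simp [ae_iff]
    filter_upwards [ae_restrict_mem measurableSet_Ico, ae_restrict_of_ae h0] with x h₁ h₂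
    exact hF x h₁ h₂
  refine ⟨hZ, fun n => by rw [hmean, hmean], hnonneg, integrableOn_of_hasSum_comp_add hG hF',
    fun j n => ?_⟩
  have h := setIntegral_exp_mul_of_hasSum hG hF' ((j : ℤ) - (n : ℤ))
  push_cast at h
  rw [h, ← hcov j n, covariance_eq_sub (hZ j) (hZ n), hmean, zero_mul, sub_zero,
    ← integral_complex_ofReal]
  simp

/-- Splitting off the central term of a sum over `ℤ`. -/
lemma hasSum_int_of_summable_ne_zero {u : ℤ → ℝ} (hu : Summable fun k : {k : ℤ // k ≠ 0} => u k) :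
    HasSum u (u 0 + ∑' k : {k : ℤ // k ≠ 0}, u k) := by
  have h0 : HasSum (fun k : ({0} : Set ℤ) => u k) (u 0) := by
    simpa using hasSum_unique (fun k : ({0} : Set ℤ) => u k)
  exact h0.add_compl (s := {0}) hu.hasSum

/-! ### Spectral densities for a general filter. -/

section General

variable {Ω : Type*} [MeasurableSpace Ω] {P : Measure Ω} {g F : ℝ → ℝ} {V X : ℝ → Ω → ℝ}

/-- The sampled velocity process has the folded square of the filter as a spectral density. -/
lemma IsVelocityProcess.hasSpectralDensity [IsProbabilityMeasure P]
    (hV : IsVelocityProcess P g V)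
    (hnonneg : ∀ x ∈ Ico (-Real.pi) Real.pi, 0 ≤ F x)
    (hF : ∀ x ∈ Ico (-Real.pi) Real.pi, x ≠ 0 →
      HasSum (fun k : ℤ => g (x + 2 * Real.pi * k) ^ 2) (F x)) :
    HasSpectralDensity P (fun n ω => V (n : ℝ) ω) F := by
  refine hasSpectralDensity_of_hasSum (fun n => hV.memLp n.cast_nonneg) (fun n => ?_)
    hV.integrable_sq (fun j n => ?_) hnonneg hF
  · have h := hV.integral_ofReal (t := n) n.cast_nonneg
    rwa [integral_complex_ofReal, Complex.ofReal_eq_zero] at h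
  · have h := hV.integral_mul (s := j) (t := n) j.cast_nonneg n.cast_nonneg
    simpa only [Complex.ofReal_natCast] using h

lemma norm_sq_div_I_mul (z : ℂ) (y : ℝ) : ‖z / (Complex.I * (y : ℂ))‖ ^ 2 = ‖z‖ ^ 2 / y ^ 2 := by
  rw [norm_div, norm_mul, Complex.norm_I, one_mul, Complex.norm_real, Real.norm_eq_abs, div_pow,
    sq_abs]

lemma norm_exp_sub_one_div_le (x : ℝ) :
    ‖(Complex.exp (Complex.I * (x : ℂ)) - 1) / (Complex.I * (x : ℂ))‖ ≤ 1 := by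
  rw [norm_div, norm_mul, Complex.norm_I, one_mul, Complex.norm_real]
  exact div_le_one_of_le₀ (Real.norm_exp_I_mul_ofReal_sub_one_le) (norm_nonneg _)

lemma exp_I_mul_add_two_pi (x : ℝ) (k : ℤ) :
    Complex.exp (Complex.I * ((x + 2 * Real.pi * k : ℝ) : ℂ)) =
      Complex.exp (Complex.I * (x : ℂ)) := by
  simpa using exp_mul_add_two_pi 1 x k

lemma IsVelocityProcess.integrable_increment (hV : IsVelocityProcess P g V) :
    Integrable (fun x : ℝ =>
      ‖(Complex.exp (Complex.I * (x : ℂ)) - 1) / (Complex.I * (x : ℂ))‖ ^ 2 * g x ^ 2) := by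
  refine hV.integrable_sq.bdd_mul (c := 1) ?_ (Eventually.of_forall fun x => ?_)
  · exact Measurable.aestronglyMeasurable (by fun_prop)
  · rw [Real.norm_of_nonneg (by positivity)]
    exact pow_le_one₀ (norm_nonneg _) (norm_exp_sub_one_div_le x)

/-- The spectral density of the unit increments of the position process. -/
lemma IsPositionProcess.hasSpectralDensity [IsProbabilityMeasure P]
    (hX : IsPositionProcess P V X)
    (hV : IsVelocityProcess P g V) (hnonneg : ∀ x ∈ Ico (-Real.pi) Real.pi, 0 ≤ F x)
    (hF : ∀ x ∈ Ico (-Real.pi) Real.pi, x ≠ 0 →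
      HasSum (fun k : ℤ => ‖Complex.exp (Complex.I * (x : ℂ)) - 1‖ ^ 2 /
        (x + 2 * Real.pi * k) ^ 2 * g (x + 2 * Real.pi * k) ^ 2) (F x)) :
    HasSpectralDensity P (fun n ω => X ((n : ℝ) + 1) ω - X (n : ℝ) ω) F := by
  refine hasSpectralDensity_of_hasSum (fun n => memLp_increment hV hX n.cast_nonneg)
    (fun n => integral_increment hV hX n.cast_nonneg) hV.integrable_increment (fun j n => ?_)
    hnonneg fun x hx hx0 => ?_
  · have h := integral_increment_mul hV hX (a := j) (b := n) j.cast_nonneg n.cast_nonneg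
    simpa only [Complex.ofReal_natCast] using h
  -- Periodicity of `e^{ix}` makes the numerator the same for all translates.
  · simp_rw [norm_sq_div_I_mul, exp_I_mul_add_two_pi]
    exact hF x hx hx0

end General

/-! ### Summability over the translates `x + 2πk`. -/

section Translates

/-- The triangle inequality gives `|x + 2πk| ≥ 2π|k| - π`, which is at least `π|k|` as `|k| ≥ 1`. -/
lemma pi_mul_abs_le {x : ℝ} (hx : x ∈ Ico (-Real.pi) Real.pi) {k : ℤ} (hk : k ≠ 0) :
    Real.pi * |(k : ℝ)| ≤ |x + 2 * Real.pi * k| := by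
  have h1 : (1 : ℝ) ≤ |(k : ℝ)| := by exact_mod_cast Int.one_le_abs hk
  have h2 : |x| ≤ Real.pi := abs_le.2 ⟨hx.1, hx.2.le⟩
  have h3 : |2 * Real.pi * (k : ℝ)| = 2 * Real.pi * |(k : ℝ)| := by
    rw [abs_mul, abs_of_pos Real.two_pi_pos]
  have h4 : |2 * Real.pi * (k : ℝ)| ≤ |x + 2 * Real.pi * k| + |x| := by
    have := abs_sub (x + 2 * Real.pi * k) x
    rwa [add_sub_cancel_left] at this
  nlinarith [Real.pi_pos]

lemma add_two_pi_mul_ne_zero {x : ℝ} (hx : x ∈ Ico (-Real.pi) Real.pi) {k : ℤ}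
    (hk : k ≠ 0) : x + 2 * Real.pi * k ≠ 0 := by
  have h := pi_mul_abs_le hx hk
  have h1 : 0 < |(k : ℝ)| := abs_pos.2 (Int.cast_ne_zero.2 hk)
  exact abs_pos.1 ((mul_pos Real.pi_pos h1).trans_le h)

lemma summable_abs_add_two_pi_rpow {p : ℝ} (hp : 1 < p) {x : ℝ}
    (hx : x ∈ Ico (-Real.pi) Real.pi) :
    Summable (fun k : {k : ℤ // k ≠ 0} => |x + 2 * Real.pi * (k : ℤ)| ^ (-p)) := by
  have h := ((Real.summable_abs_int_rpow hp).mul_left (Real.pi ^ (-p))).comp_injective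
    (Subtype.val_injective (p := fun k : ℤ => k ≠ 0))
  refine h.of_nonneg_of_le (fun k => by positivity) fun k => ?_
  have h1 : 0 < |((k : ℤ) : ℝ)| := abs_pos.2 (Int.cast_ne_zero.2 k.2)
  rw [Function.comp_apply, ← Real.mul_rpow Real.pi_pos.le h1.le]
  exact Real.rpow_le_rpow_of_nonpos (mul_pos Real.pi_pos h1) (pi_mul_abs_le hx k.2) (by linarith)

end Translates

lemma sin_pi_mul_pos {d : ℝ} (h₁ : -(1 / 2) < d) (h₂ : d < 1 / 2) :
    0 < Real.sin (Real.pi * (d + 1 / 2)) :=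
  Real.sin_pos_of_pos_of_lt_pi (mul_pos Real.pi_pos (by linarith))
    (by nlinarith [Real.pi_pos])

/-! ### The fractional Ornstein–Uhlenbeck process. -/

section FOU

variable {σ ζ d : ℝ}

lemma fouFilter_sq (h₁ : -(1 / 2) < d) (h₂ : d < 1 / 2) (y : ℝ) :
    fouFilter σ ζ d y ^ 2 = σ ^ 2 * Real.Gamma (2 * d + 2) * Real.sin (Real.pi * (d + 1 / 2)) *
      (1 / (ζ ^ 2 + y ^ 2) * (1 / |y| ^ (2 * d))) := by
  have hs := sin_pi_mul_pos h₁ h₂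
  have hG : 0 < Real.Gamma (2 * d + 2) := Real.Gamma_pos_of_pos (by linarith)
  have hr : (|y| ^ (-d)) ^ 2 = 1 / |y| ^ (2 * d) := by
    rw [← Real.rpow_mul_natCast (abs_nonneg y), one_div, ← Real.rpow_neg (abs_nonneg y)]
    congr 1
    push_cast
    ring
  rw [fouFilter, mul_pow, mul_pow, mul_pow, div_pow, Real.sq_sqrt (mul_pos hG hs).le,
    Real.sq_sqrt (by positivity), hr]
  ring

/-- Dropping `ζ²` bounds the term by `|x + 2πk|^{-(2+2d)}`, and `2 + 2d > 1` is the condition `d >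
-1/2`. -/
lemma summable_fouVelocityTerm (h₁ : -(1 / 2) < d) {x : ℝ} (hx : x ∈ Ico (-Real.pi) Real.pi) :
    Summable (fun k : {k : ℤ // k ≠ 0} => fouVelocityTerm ζ d x k) := by
  refine (summable_abs_add_two_pi_rpow (p := 2 + 2 * d) (by linarith) hx).of_nonneg_of_le
    (fun k => by unfold fouVelocityTerm; positivity) fun k => ?_
  have hy := abs_pos.2 (add_two_pi_mul_ne_zero hx k.2)
  rw [fouVelocityTerm, mul_right_comm 2 _ Real.pi]
  set y := x + 2 * Real.pi * ((k : ℤ) : ℝ)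
  rw [neg_add, Real.rpow_add hy, Real.rpow_neg hy.le, Real.rpow_neg hy.le, Real.rpow_two, sq_abs,
    one_div, one_div]
  have : 0 < y ^ 2 := by rw [← sq_abs]; positivity
  gcongr
  nlinarith [sq_nonneg ζ]

lemma fouIncrementTerm_eq {x : ℝ} {k : ℤ} (hy : x + 2 * Real.pi * k ≠ 0) :
    fouIncrementTerm ζ d x k = 1 / (x + 2 * Real.pi * k) ^ 2 *
      (1 / (ζ ^ 2 + (x + 2 * Real.pi * k) ^ 2) * (1 / |x + 2 * Real.pi * k| ^ (2 * d))) := by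
  rw [fouIncrementTerm, mul_right_comm 2 _ Real.pi, Real.rpow_add (abs_pos.2 hy), Real.rpow_two, sq_abs]
  field_simp

/-- Since `|x + 2πk| ≥ π|k| ≥ 1`, the extra factor `1/(x+2πk)²` is at most `1`, and the velocity
terms dominate. -/
lemma summable_fouIncrementTerm (h₁ : -(1 / 2) < d) {x : ℝ} (hx : x ∈ Ico (-Real.pi) Real.pi) :
    Summable (fun k : {k : ℤ // k ≠ 0} => fouIncrementTerm ζ d x k) := by
  refine (summable_fouVelocityTerm (ζ := ζ) h₁ hx).of_nonneg_of_le
    (fun k => by unfold fouIncrementTerm; positivity) fun k => ?_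
  rw [fouIncrementTerm_eq (add_two_pi_mul_ne_zero hx k.2), fouVelocityTerm, mul_right_comm 2 _ Real.pi]
  refine mul_le_of_le_one_left (by positivity) ?_
  have h := pi_mul_abs_le hx k.2
  have h1 : (1 : ℝ) ≤ |((k : ℤ) : ℝ)| := by exact_mod_cast Int.one_le_abs k.2
  have h2 : 1 ≤ |x + 2 * Real.pi * ((k : ℤ) : ℝ)| := by nlinarith [Real.pi_gt_three]
  rw [← sq_abs]
  exact div_le_one_of_le₀ (one_le_pow₀ h2) (by positivity)

lemma hasSpectralDensity_fouVelocity {Ω : Type*} [MeasurableSpace Ω] {P : Measure Ω}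
    [IsProbabilityMeasure P] (h₁ : -(1 / 2) < d) (h₂ : d < 1 / 2) {V : ℝ → Ω → ℝ}
    (hV : IsVelocityProcess P (fouFilter σ ζ d) V) :
    HasSpectralDensity P (fun n ω => V (n : ℝ) ω) (fouVelocityDensity σ ζ d) := by
  have hs := sin_pi_mul_pos h₁ h₂
  have hG : 0 < Real.Gamma (2 * d + 2) := Real.Gamma_pos_of_pos (by linarith)
  refine hV.hasSpectralDensity (fun x _ => ?_) fun x hx _ => ?_
  · have : 0 ≤ ∑' k : {k : ℤ // k ≠ 0}, fouVelocityTerm ζ d x k :=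
      tsum_nonneg fun k => by unfold fouVelocityTerm; positivity
    unfold fouVelocityDensity
    positivity
  · have h := (hasSum_int_of_summable_ne_zero (summable_fouVelocityTerm (ζ := ζ) h₁ hx)).mul_left
      (σ ^ 2 * Real.Gamma (2 * d + 2) * Real.sin (Real.pi * (d + 1 / 2)))
    simp only [fouFilter_sq h₁ h₂]
    have h0 : fouVelocityTerm ζ d x 0 = 1 / (ζ ^ 2 + x ^ 2) * (1 / |x| ^ (2 * d)) := by
      simp [fouVelocityTerm]
    rw [fouVelocityDensity, ← h0]
    refine h.congr_fun fun k => ?_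
    rw [fouVelocityTerm, mul_right_comm 2 _ Real.pi]

/-- The two expressions differ by the unimodular factor `e^{ix}`; this reconciles the form used in
the fOU density with the one produced by averaging. -/
lemma norm_one_sub_exp_neg (x : ℝ) : ‖1 - Complex.exp (-(Complex.I * (x : ℂ)))‖ =
    ‖Complex.exp (Complex.I * (x : ℂ)) - 1‖ := by
  have h : Complex.exp (Complex.I * (x : ℂ)) - 1 =
      Complex.exp (Complex.I * (x : ℂ)) * (1 - Complex.exp (-(Complex.I * (x : ℂ)))) := by
    rw [mul_sub, mul_one, ← Complex.exp_add, add_neg_cancel, Complex.exp_zero]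
  rw [h, norm_mul, mul_comm Complex.I, Complex.norm_exp_ofReal_mul_I, one_mul]

lemma hasSpectralDensity_fouIncrement {Ω : Type*} [MeasurableSpace Ω] {P : Measure Ω}
    [IsProbabilityMeasure P] (h₁ : -(1 / 2) < d) (h₂ : d < 1 / 2) {V X : ℝ → Ω → ℝ}
    (hV : IsVelocityProcess P (fouFilter σ ζ d) V) (hX : IsPositionProcess P V X) :
    HasSpectralDensity P (fun n ω => X ((n : ℝ) + 1) ω - X (n : ℝ) ω)
      (fouIncrementDensity σ ζ d) := by
  have hs := sin_pi_mul_pos h₁ h₂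
  have hG : 0 < Real.Gamma (2 * d + 2) := Real.Gamma_pos_of_pos (by linarith)
  refine hX.hasSpectralDensity hV (fun x _ => ?_) fun x hx hx0 => ?_
  · have : 0 ≤ ∑' k : {k : ℤ // k ≠ 0}, fouIncrementTerm ζ d x k :=
      tsum_nonneg fun k => by unfold fouIncrementTerm; positivity
    unfold fouIncrementDensity
    positivity
  · have h := (hasSum_int_of_summable_ne_zero (summable_fouIncrementTerm (ζ := ζ) h₁ hx)).mul_left
      (σ ^ 2 * Real.Gamma (2 * d + 2) * Real.sin (Real.pi * (d + 1 / 2)) *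
        ‖Complex.exp (Complex.I * (x : ℂ)) - 1‖ ^ 2)
    have hy : ∀ k : ℤ, x + 2 * Real.pi * k ≠ 0 := by
      intro k
      rcases eq_or_ne k 0 with rfl | hk
      · simpa using hx0
      · exact add_two_pi_mul_ne_zero hx hk
    simp only [fouFilter_sq h₁ h₂]
    have h0 := fouIncrementTerm_eq (ζ := ζ) (d := d) (hy 0)
    simp only [Int.cast_zero, mul_zero, add_zero] at h0
    -- The separately displayed central term is the `k = 0` term of the aliased series, which needs
    -- `x ≠ 0`.
    have hval : fouIncrementDensity σ ζ d x = σ ^ 2 * Real.Gamma (2 * d + 2) *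
        Real.sin (Real.pi * (d + 1 / 2)) * ‖Complex.exp (Complex.I * (x : ℂ)) - 1‖ ^ 2 *
        (fouIncrementTerm ζ d x 0 + ∑' k : {k : ℤ // k ≠ 0}, fouIncrementTerm ζ d x k) := by
      rw [h0, fouIncrementDensity, norm_sq_div_I_mul, norm_one_sub_exp_neg]
      ring
    rw [hval]
    refine h.congr_fun fun k => ?_
    rw [fouIncrementTerm_eq (hy k)]
    ring

end FOU

/-! ### The fractional generalized Langevin equation. -/

section FGLE

variable {ζ m kB τ d : ℝ}

/-- The denominator `a² + b² + 2bm|x|^β + m²|x|^{2β}` of the squared filter. -/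
def fgleDenominator (ζ m d y : ℝ) : ℝ :=
  (fgleA ζ d ^ 2 + fgleB ζ d ^ 2) + 2 * fgleB ζ d * m * |y| ^ (1 + 2 * d) +
      m ^ 2 * |y| ^ (2 * (1 + 2 * d))

/-- Completing the square in `b + m|y|^β` bounds the denominator below by `a²`, whatever the sign of
`b`. -/
lemma fgleDenominator_eq (y : ℝ) : fgleDenominator ζ m d y =
    fgleA ζ d ^ 2 + (fgleB ζ d + m * |y| ^ (1 + 2 * d)) ^ 2 := by
  rw [fgleDenominator, mul_comm 2 (1 + 2 * d), Real.rpow_mul (abs_nonneg y), Real.rpow_two]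
  ring

lemma fgleA_pos (hζ : 0 < ζ) (h₁ : 0 < d) (h₂ : d < 1 / 2) : 0 < fgleA ζ d :=
  mul_pos (mul_pos hζ (Real.Gamma_pos_of_pos (by linarith))) (sin_pi_mul_pos (by linarith) h₂)

lemma sq_fgleA_le_fgleDenominator (y : ℝ) : fgleA ζ d ^ 2 ≤ fgleDenominator ζ m d y := by
  rw [fgleDenominator_eq]
  exact le_add_of_nonneg_right (sq_nonneg _)

lemma fgleFilter_sq (y : ℝ) : fgleFilter ζ m kB τ d y ^ 2 =
    fgleC ζ kB τ d ^ 2 * (|y| ^ (2 * d) / fgleDenominator ζ m d y) := by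
  have hr : (|y| ^ d) ^ 2 = |y| ^ (2 * d) := by
    rw [← Real.rpow_mul_natCast (abs_nonneg y), mul_comm]
    rfl
  have hD : 0 ≤ fgleDenominator ζ m d y := (sq_nonneg _).trans (sq_fgleA_le_fgleDenominator y)
  rw [fgleFilter, ← fgleDenominator, mul_pow, mul_pow, div_pow, Real.sq_sqrt hD, hr]
  ring

/-- The complex number inverted has real part `a|y|^{-2d}` and imaginary part `-sign(y)(b|y|^{-2d} +
m|y|)`. Factoring out `|y|^{-2d}` leaves squared modulus `a² + (b + m|y|^{1+2d})²`, the completed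
square of the filter's denominator. -/
lemma fgleTransfer_eq {y : ℝ} (hy : y ≠ 0) :
    fgleTransfer ζ m d y = (|y| ^ (2 * d)) ^ 2 / fgleDenominator ζ m d y := by
  have hr : 0 < |y| := abs_pos.2 hy
  have hp : 0 < |y| ^ (2 * d) := Real.rpow_pos_of_pos hr _
  have hs : Real.sign y * y = |y| ∧ Real.sign y ^ 2 = 1 := by
    rcases lt_or_gt_of_ne hy with h | h
    · rw [Real.sign_of_neg h, abs_of_neg h]; constructor <;> ring
    · rw [Real.sign_of_pos h, abs_of_pos h]; constructor <;> ring
  have hz : (ζ : ℂ) * kappa d y * ((|y| ^ (-2 * d) : ℝ) : ℂ) - Complex.I * (m : ℂ) * (y : ℂ) =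
      ((fgleA ζ d * (|y| ^ (2 * d))⁻¹ : ℝ) : ℂ) +
        ((-(Real.sign y * fgleB ζ d * (|y| ^ (2 * d))⁻¹ + m * y) : ℝ) : ℂ) * Complex.I := by
    rw [kappa, fgleA, fgleB, neg_mul, Real.rpow_neg hr.le,
      show 2 * (d + 1 / 2) + 1 = 2 * d + 2 by ring, mul_comm (d + 1 / 2) Real.pi]
    push_cast
    ring
  rw [fgleTransfer, hz, norm_div, norm_one, div_pow, one_pow, ← Complex.normSq_eq_norm_sq,
    Complex.normSq_add_mul_I, fgleDenominator_eq, Real.rpow_add hr, Real.rpow_one]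
  generalize |y| ^ (2 * d) = p at hp
  have h : (fgleA ζ d * p⁻¹) ^ 2 + (-(Real.sign y * fgleB ζ d * p⁻¹ + m * y)) ^ 2 =
      (fgleA ζ d ^ 2 + (fgleB ζ d + m * (|y| * p)) ^ 2) / p ^ 2 := by
    rw [← hs.1]
    have hy2 : (Real.sign y * y) ^ 2 = y ^ 2 := by rw [mul_pow, hs.2, one_mul]
    field_simp
    -- The cross terms already agree; the pure squares agree after `sign(y)² = 1`.
    linear_combination fgleB ζ d ^ 2 * hs.2 - m ^ 2 * p ^ 2 * hy2
  rw [h, one_div_div]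

lemma fgleIncrementTerm_eq {x : ℝ} {k : ℤ} (hy : x + 2 * Real.pi * k ≠ 0) :
    fgleIncrementTerm ζ m d x k = 1 / (x + 2 * Real.pi * k) ^ 2 *
      (|x + 2 * Real.pi * k| ^ (2 * d) / fgleDenominator ζ m d (x + 2 * Real.pi * k)) := by
  have hr := abs_pos.2 hy
  rw [fgleIncrementTerm, fgleTransfer_eq hy,
    show -2 * (d + 1) = -(2 * d) + -2 by ring, Real.rpow_add hr, Real.rpow_neg hr.le,
    Real.rpow_neg hr.le, Real.rpow_two, sq_abs]
  have := (Real.rpow_pos_of_pos hr (2 * d)).ne'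
  field_simp

lemma fgleIncrementTerm_nonneg (x : ℝ) (k : ℤ) : 0 ≤ fgleIncrementTerm ζ m d x k := by
  unfold fgleIncrementTerm fgleTransfer
  positivity

/-- Bounding the denominator below by `a² > 0` leaves `|x + 2πk|^{-(2-2d)}`, and `2 - 2d > 1` is the
condition `d < 1/2`. -/
lemma summable_fgleIncrementTerm (hζ : 0 < ζ) (h₁ : 0 < d) (h₂ : d < 1 / 2) {x : ℝ}
    (hx : x ∈ Ico (-Real.pi) Real.pi) :
    Summable (fun k : {k : ℤ // k ≠ 0} => fgleIncrementTerm ζ m d x k) := by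
  refine ((summable_abs_add_two_pi_rpow (p := 2 - 2 * d) (by linarith) hx).mul_left
    (1 / fgleA ζ d ^ 2)).of_nonneg_of_le (fun k => fgleIncrementTerm_nonneg x k) fun k => ?_
  have hy := add_two_pi_mul_ne_zero hx k.2
  have hr := abs_pos.2 hy
  have hA := fgleA_pos hζ h₁ h₂
  rw [fgleIncrementTerm_eq hy, show -(2 - 2 * d) = 2 * d + -2 by ring, Real.rpow_add hr,
    Real.rpow_neg hr.le, Real.rpow_two, sq_abs]
  set y := x + 2 * Real.pi * ((k : ℤ) : ℝ)
  have hp : 0 < |y| ^ (2 * d) := Real.rpow_pos_of_pos hr _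
  have h : |y| ^ (2 * d) / fgleDenominator ζ m d y ≤ |y| ^ (2 * d) / fgleA ζ d ^ 2 :=
    div_le_div_of_nonneg_left hp.le (by positivity) (sq_fgleA_le_fgleDenominator y)
  calc _ ≤ 1 / y ^ 2 * (|y| ^ (2 * d) / fgleA ζ d ^ 2) := by gcongr
    _ = _ := by ring

lemma hasSpectralDensity_fgleIncrement {Ω : Type*} [MeasurableSpace Ω] {P : Measure Ω}
    [IsProbabilityMeasure P] (hζ : 0 < ζ) (h₁ : 0 < d) (h₂ : d < 1 / 2) {V X : ℝ → Ω → ℝ}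
    (hV : IsVelocityProcess P (fgleFilter ζ m kB τ d) V) (hX : IsPositionProcess P V X) :
    HasSpectralDensity P (fun n ω => X ((n : ℝ) + 1) ω - X (n : ℝ) ω)
      (fgleIncrementDensity ζ m kB τ d) := by
  refine hX.hasSpectralDensity hV (fun x _ => ?_) fun x hx hx0 => ?_
  · have : 0 ≤ ∑' k : {k : ℤ // k ≠ 0}, fgleIncrementTerm ζ m d x k :=
      tsum_nonneg fun k => fgleIncrementTerm_nonneg x k
    unfold fgleIncrementDensity fgleTransfer
    positivity
  · have h := (hasSum_int_of_summable_ne_zero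
      (summable_fgleIncrementTerm (m := m) hζ h₁ h₂ hx)).mul_left
      (fgleC ζ kB τ d ^ 2 * ‖Complex.exp (Complex.I * (x : ℂ)) - 1‖ ^ 2)
    have hy : ∀ k : ℤ, x + 2 * Real.pi * k ≠ 0 := by
      intro k
      rcases eq_or_ne k 0 with rfl | hk
      · simpa using hx0
      · exact add_two_pi_mul_ne_zero hx hk
    simp only [fgleFilter_sq]
    have h0 := fgleIncrementTerm_eq (ζ := ζ) (m := m) (d := d) (hy 0)
    simp only [Int.cast_zero, mul_zero, add_zero] at h0
    have hval : fgleIncrementDensity ζ m kB τ d x =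
        fgleC ζ kB τ d ^ 2 * ‖Complex.exp (Complex.I * (x : ℂ)) - 1‖ ^ 2 *
        (fgleIncrementTerm ζ m d x 0 + ∑' k : {k : ℤ // k ≠ 0}, fgleIncrementTerm ζ m d x k) := by
      have hr := abs_pos.2 hx0
      have hp := (Real.rpow_pos_of_pos hr (2 * d)).ne'
      rw [h0, fgleIncrementDensity, norm_sq_div_I_mul, fgleTransfer_eq hx0, neg_mul,
        Real.rpow_neg hr.le]
      field_simp
    rw [hval]
    refine h.congr_fun fun k => ?_
    rw [fgleIncrementTerm_eq (hy k)]
    ring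

end FGLE

end AnomalousDiffusion

end

theorem mainTheorem5 {Ω : Type*} [MeasurableSpace Ω] (P : Measure Ω) [IsProbabilityMeasure P] :
    -- increments of the fGLE position process
    (∀ (ζ m kB τ d : ℝ), 0 < ζ → 0 < m → 0 < kB → 0 < τ → 0 < d → d < 1 / 2 →
      ∀ V X : ℝ → Ω → ℝ,
        AnomalousDiffusion.IsVelocityProcess P
          (AnomalousDiffusion.fgleFilter ζ m kB τ d) V →
        AnomalousDiffusion.IsPositionProcess P V X →
        (∀ x ∈ Ico (-Real.pi) Real.pi,
          Summable (fun k : {k : ℤ // k ≠ 0} =>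
            AnomalousDiffusion.fgleIncrementTerm ζ m d x k)) ∧
        AnomalousDiffusion.HasSpectralDensity P
          (fun n ω => X ((n : ℝ) + 1) ω - X (n : ℝ) ω)
          (AnomalousDiffusion.fgleIncrementDensity ζ m kB τ d)) ∧
    (∀ (σ ζ d : ℝ), 0 < ζ → -(1 / 2) < d → d < 1 / 2 →
      ∀ V : ℝ → Ω → ℝ,
        AnomalousDiffusion.IsVelocityProcess P (AnomalousDiffusion.fouFilter σ ζ d) V →
        -- the fOU velocity process sampled at the integers
        ((∀ x ∈ Ico (-Real.pi) Real.pi,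
            Summable (fun k : {k : ℤ // k ≠ 0} =>
              AnomalousDiffusion.fouVelocityTerm ζ d x k)) ∧
          AnomalousDiffusion.HasSpectralDensity P (fun n ω => V (n : ℝ) ω)
            (AnomalousDiffusion.fouVelocityDensity σ ζ d)) ∧
        -- increments of the fOU position process
        (∀ X : ℝ → Ω → ℝ, AnomalousDiffusion.IsPositionProcess P V X →
          (∀ x ∈ Ico (-Real.pi) Real.pi,
            Summable (fun k : {k : ℤ // k ≠ 0} =>
              AnomalousDiffusion.fouIncrementTerm ζ d x k)) ∧
          AnomalousDiffusion.HasSpectralDensity P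
            (fun n ω => X ((n : ℝ) + 1) ω - X (n : ℝ) ω)
            (AnomalousDiffusion.fouIncrementDensity σ ζ d))) := by
  refine ⟨fun ζ m kB τ d hζ _ _ _ h₁ h₂ V X hV hX => ⟨fun x hx => ?_, ?_⟩,
    fun σ ζ d _ h₁ h₂ V hV => ⟨⟨fun x hx => ?_, ?_⟩, fun X hX => ⟨fun x hx => ?_, ?_⟩⟩⟩
  · exact AnomalousDiffusion.summable_fgleIncrementTerm hζ h₁ h₂ hx
  · exact AnomalousDiffusion.hasSpectralDensity_fgleIncrement hζ h₁ h₂ hV hX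
  · exact AnomalousDiffusion.summable_fouVelocityTerm h₁ hx
  · exact AnomalousDiffusion.hasSpectralDensity_fouVelocity h₁ h₂ hV
  · exact AnomalousDiffusion.summable_fouIncrementTerm h₁ hx
  · exact AnomalousDiffusion.hasSpectralDensity_fouIncrement h₁ h₂ hV hX
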